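/- A gyrogroup is a set $G$ with a binary operation $\oplus$ having a two-sided identity $0$, two-sided inverses $\ominus x$, and automorphisms $\operatorname{gyr}[x,y]\in\operatorname{Aut}(G,\oplus)$ ($x,y\in G$) such that $x\oplus(y\oplus z)=(x\oplus y)\oplus\operatorname{gyr}[x,y](z)$ and $\operatorname{gyr}[x\oplus y,y]=\operatorname{gyr}[x,y]$ for all $x,y,z\in G$. A topological gyrogroup is a gyrogroup with a topology for which $\oplus$ is jointly continuous and $\ominus$ is continuous; it is strongly topological if $0$ has a neighborhood base $\mathscr U$ such that $\operatorname{gyr}[x,y](U)=U$ for all $U\in\mathscr U$ and $x,y\in G$. A subgyrogroup is a nonempty subset that is closed under $\oplus$ and $\ominus$ (equivalently, a nonempty subset closed under $\oplus$ that is a gyrogroup under the restricted operation); a subgyrogroup $H$ is an $L$-subgyrogroup if $\operatorname{gyr}[a,h](H)=H$ for all $a\in G$, $h\in H$. In that case $G/H$ denotes the set of left cosets $a\oplus H$, $a\in G$, with the quotient topology of the map $a\mapsto a\oplus H$. A space $X$ is feathered if it contains a nonempty compact set $K$ of countable character, i.e. there is a countable family of open sets containing $K$ such that every open set containing $K$ contains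 a member of the family. **Theorem.** Let $G$ be a strongly topological gyrogroup whose topology is $T_1$. Then $G$ is feathered if and only if $G$ contains a compact $L$-subgyrogroup $H$ such that the coset space $G/H$ is metrizable. -/

import Mathlib

open Topology

/-- A gyrogroup, written additively: `x + y` is `x ⊕ y`, `-x` is `⊖ x`, and `gyr x y` is the
gyroautomorphism `gyr[x, y]`. Uniqueness of the identity and of inverses is a consequence, see
`Gyrogroup.zero_unique` and `Gyrogroup.neg_unique`. -/
class Gyrogroup (G : Type*) extends Add G, Zero G, Neg G where
  zero_add' : ∀ a : G, 0 + a = a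
  add_zero' : ∀ a : G, a + 0 = a
  neg_add' : ∀ a : G, -a + a = 0
  add_neg' : ∀ a : G, a + -a = 0
  gyr : G → G → G ≃+ G
  gyr_assoc : ∀ x y z : G, x + (y + z) = (x + y) + gyr x y z
  gyr_loop : ∀ x y : G, gyr (x + y) y = gyr x y

namespace Gyrogroup

section Basic

variable {G : Type*} [Gyrogroup G]

theorem zero_unique (e : G) (he : ∀ a : G, e + a = a ∧ a + e = a) : e = 0 := by
  rw [← (he 0).2, zero_add']

theorem add_left_cancel' (x a b : G) (h : x + a = x + b) : a = b := by
  have h2 : -x + (x + a) = -x + (x + b) := by rw [h]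
  rw [gyr_assoc, gyr_assoc, neg_add', zero_add', zero_add'] at h2
  exact (gyr (-x) x).injective h2

theorem neg_unique (x y : G) (h : y + x = 0 ∧ x + y = 0) : y = -x :=
  add_left_cancel' x y (-x) (h.2.trans (add_neg' x).symm)

theorem gyr_zero_left (x y : G) : gyr 0 x y = y := by
  have h := gyr_assoc 0 x y
  rw [zero_add', zero_add'] at h
  exact (add_left_cancel' x _ _ h).symm

theorem neg_add_cancel_left' (x y : G) : -x + (x + y) = y := by
  rw [gyr_assoc, neg_add', zero_add', ← gyr_loop, neg_add', gyr_zero_left]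

theorem gyr_eq (x y z : G) : gyr x y z = -(x + y) + (x + (y + z)) := by
  rw [gyr_assoc x y z, neg_add_cancel_left']

theorem add_neg_cancel_left' (x y : G) : x + (-x + y) = y := by
  apply add_left_cancel' (-x)
  rw [neg_add_cancel_left']

theorem gyr_symm_eq (x y w : G) : (gyr x y).symm w = -y + (-x + ((x + y) + w)) := by
  apply (gyr x y).injective
  rw [AddEquiv.apply_symm_apply, gyr_eq, add_neg_cancel_left', add_neg_cancel_left',
    neg_add_cancel_left']

end Basic

section Sub

variable {G : Type*} [Gyrogroup G]

/-- A subgyrogroup: a nonempty subset closed under `⊖` and `⊕`. Equivalently, it is nonempty,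
closed under `⊕`, and a gyrogroup under the restricted operation, see `isSubgyrogroup_iff`. -/
structure IsSubgyrogroup (H : Set G) : Prop where
  nonempty : H.Nonempty
  neg_mem : ∀ x ∈ H, -x ∈ H
  add_mem : ∀ x ∈ H, ∀ y ∈ H, x + y ∈ H

theorem isSubgyrogroup_iff (H : Set G) :
    IsSubgyrogroup H ↔ H.Nonempty ∧ (∀ x ∈ H, ∀ y ∈ H, x + y ∈ H) ∧
      ∃ S : Gyrogroup H, ∀ x y : H, ((S.toAdd.add x y : H) : G) = (x : G) + (y : G) := by
  constructor
  · intro h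
    have h0 : (0 : G) ∈ H := by
      obtain ⟨x, hx⟩ := h.nonempty
      rw [← neg_add' x]
      exact h.add_mem _ (h.neg_mem _ hx) _ hx
    have hg : ∀ x ∈ H, ∀ y ∈ H, ∀ z ∈ H, gyr x y z ∈ H := by
      intro x hx y hy z hz
      rw [gyr_eq]
      exact h.add_mem _ (h.neg_mem _ (h.add_mem _ hx _ hy)) _
        (h.add_mem _ hx _ (h.add_mem _ hy _ hz))
    have hs : ∀ x ∈ H, ∀ y ∈ H, ∀ z ∈ H, (gyr x y).symm z ∈ H := by
      intro x hx y hy z hz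
      rw [gyr_symm_eq]
      exact h.add_mem _ (h.neg_mem _ hy) _ (h.add_mem _ (h.neg_mem _ hx) _
        (h.add_mem _ (h.add_mem _ hx _ hy) _ hz))
    refine ⟨h.nonempty, h.add_mem, ?_⟩
    let _ : Add H := ⟨fun x y => ⟨x + y, h.add_mem _ x.2 _ y.2⟩⟩
    let _ : Zero H := ⟨⟨0, h0⟩⟩
    let _ : Neg H := ⟨fun x => ⟨-x, h.neg_mem _ x.2⟩⟩
    exact
      ⟨{ zero_add' := fun a => Subtype.ext (zero_add' (a : G))
         add_zero' := fun a => Subtype.ext (add_zero' (a : G))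
         neg_add' := fun a => Subtype.ext (neg_add' (a : G))
         add_neg' := fun a => Subtype.ext (add_neg' (a : G))
         gyr := fun x y =>
          { toFun := fun z => ⟨gyr (x : G) y z, hg _ x.2 _ y.2 _ z.2⟩
            invFun := fun z => ⟨(gyr (x : G) y).symm z, hs _ x.2 _ y.2 _ z.2⟩
            left_inv := fun z => Subtype.ext ((gyr (x : G) y).symm_apply_apply z)
            right_inv := fun z => Subtype.ext ((gyr (x : G) y).apply_symm_apply z)
            map_add' := fun a b => Subtype.ext ((gyr (x : G) y).map_add a b) }
         gyr_assoc := fun x y z => Subtype.ext (gyr_assoc (x : G) y z)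
         gyr_loop := fun x y => by
          ext z
          exact DFunLike.congr_fun (gyr_loop (x : G) y) (z : G) }, fun x y => rfl⟩
  · rintro ⟨hne, hadd, S, hS⟩
    have hz : ((S.toZero.zero : H) : G) = 0 := by
      apply add_left_cancel' ((S.toZero.zero : H) : G)
      rw [← hS, add_zero']
      exact congrArg Subtype.val (S.zero_add' S.toZero.zero)
    refine ⟨hne, fun x hx => ?_, hadd⟩
    have h1 : ((S.toNeg.neg ⟨x, hx⟩ : H) : G) = -x := by
      apply add_left_cancel' x
      rw [add_neg', ← hS ⟨x, hx⟩, ← hz]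
      exact congrArg Subtype.val (S.add_neg' ⟨x, hx⟩)
    rw [← h1]
    exact Subtype.property _

/-- An `L`-subgyrogroup: a subgyrogroup `H` with `gyr[a, h](H) = H` for all `a ∈ G`, `h ∈ H`. -/
structure IsLSubgyrogroup (H : Set G) : Prop extends IsSubgyrogroup H where
  gyr_image : ∀ a : G, ∀ h ∈ H, gyr a h '' H = H

/-- The left coset `a ⊕ H`. -/
def leftCoset (a : G) (H : Set G) : Set G := (fun h => a + h) '' H

/-- The relation `a ⊕ H = b ⊕ H`. -/
def cosetSetoid (H : Set G) : Setoid G := Setoid.ker (fun a => leftCoset a H)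

/-- The coset space `G / H` of the left cosets `a ⊕ H`. When `G` is a topological space it carries
the quotient topology with respect to `a ↦ a ⊕ H`. -/
abbrev CosetSpace (H : Set G) : Type _ := Quotient (cosetSetoid H)

end Sub

end Gyrogroup

/-- A topological gyrogroup: `⊕` is jointly continuous and `⊖` is continuous. -/
class IsTopologicalGyrogroup (G : Type*) [TopologicalSpace G] [Gyrogroup G] : Prop
    extends ContinuousAdd G, ContinuousNeg G

/-- A strongly topological gyrogroup: there is a neighbourhood base at `0` whose members are
invariant under all gyroautomorphisms. -/
class IsStronglyTopologicalGyrogroup (G : Type*) [TopologicalSpace G] [Gyrogroup G] : Prop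
    extends IsTopologicalGyrogroup G where
  exists_gyr_invariant_basis : ∃ 𝓤 : Set (Set G),
    (𝓝 (0 : G)).HasBasis (fun U => U ∈ 𝓤) id ∧
      ∀ U ∈ 𝓤, ∀ x y : G, Gyrogroup.gyr x y '' U = U

/-- `γ` is a base for the space `X` at the set `F`. -/
def IsBaseAtSet {X : Type*} [TopologicalSpace X] (γ : Set (Set X)) (F : Set X) : Prop :=
  (∀ U ∈ γ, IsOpen U ∧ F ⊆ U) ∧ ∀ V : Set X, IsOpen V → F ⊆ V → ∃ U ∈ γ, U ⊆ V

/-- The set `F` has countable character in `X`: there is a countable base for `X` at `F`. -/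
def HasCountableCharacter {X : Type*} [TopologicalSpace X] (F : Set X) : Prop :=
  ∃ γ : Set (Set X), γ.Countable ∧ IsBaseAtSet γ F

/-- A space is feathered if it contains a nonempty compact set of countable character. -/
def IsFeathered (X : Type*) [TopologicalSpace X] : Prop :=
  ∃ K : Set X, K.Nonempty ∧ IsCompact K ∧ HasCountableCharacter K

/-! If `H` is compact and `G/H` is metrizable, then `H` itself has countable character: by a tube
argument, each open set around `H` contains an open union of cosets around `H`, so a countable base
at the point `H` of `G/H` pulls back to one at `H`.

Conversely, translate the compact set `K` so that `0 ∈ K`, and choose symmetric gyro-invariant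
neighbourhoods `V n` of `0`, with `V (n + 1) ⊕ V (n + 1) ⊆ V n`, refining a countable base at `K`.
Their intersection `H` is a closed `L`-subgyrogroup, contained in `K` by `T₁`, and compactness makes
the `V n` shrink to `H`. Gyro-invariance replaces associativity in showing that the relations `⊖x ⊕
y ∈ V n` generate a uniformity (`IsInvariantChain.uniformCore`). It is countably generated and its
separation quotient is `G/H`, which is therefore metrizable
(`IsInvariantChain.metrizableSpace_cosetSpace`). -/

open Filter Set Uniformity

namespace Gyrogroup

/-! ### Gyrogroup identities and left cosets -/

section Algebra

variable {G : Type*} [Gyrogroup G]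

theorem gyr_map_zero (x y : G) : gyr x y 0 = 0 := by
  rw [gyr_eq, add_zero', neg_add']

theorem gyr_map_neg (x y z : G) : gyr x y (-z) = -gyr x y z := by
  apply neg_unique
  rw [← map_add, ← map_add, neg_add', add_neg', gyr_map_zero]
  exact ⟨rfl, rfl⟩

theorem neg_neg' (x : G) : -(-x) = x :=
  (neg_unique (-x) x ⟨add_neg' x, neg_add' x⟩).symm

theorem add_add_gyr_neg (x v : G) : (x + v) + gyr x v (-v) = x := by
  rw [← gyr_assoc, add_neg', add_zero']

theorem add_assoc_gyr_symm (x v w : G) : (x + v) + w = x + (v + (gyr x v).symm w) := by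
  rw [gyr_assoc, AddEquiv.apply_symm_apply]

theorem IsSubgyrogroup.zero_mem {H : Set G} (hH : IsSubgyrogroup H) : (0 : G) ∈ H := by
  obtain ⟨x, hx⟩ := hH.nonempty
  rw [← neg_add' x]
  exact hH.add_mem _ (hH.neg_mem _ hx) _ hx

theorem IsSubgyrogroup.leftCoset_eq_self {H : Set G} (hH : IsSubgyrogroup H) {h : G}
    (hh : h ∈ H) : leftCoset h H = H := by
  apply Subset.antisymm
  · rintro _ ⟨k, hk, rfl⟩
    exact hH.add_mem _ hh _ hk
  · intro k hk
    exact ⟨-h + k, hH.add_mem _ (hH.neg_mem _ hh) _ hk, add_neg_cancel_left' h k⟩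

theorem leftCoset_zero (H : Set G) : leftCoset 0 H = H := by
  simp [leftCoset, zero_add']

theorem mem_leftCoset_iff {H : Set G} {x y : G} : y ∈ leftCoset x H ↔ -x + y ∈ H := by
  constructor
  · rintro ⟨h, hh, rfl⟩
    simpa only [neg_add_cancel_left'] using hh
  · intro h
    exact ⟨_, h, add_neg_cancel_left' x y⟩

/-- The `L`-condition absorbs the gyration: `(x ⊕ h) ⊕ H = (x ⊕ h) ⊕ gyr[x, h](H) = x ⊕ (h ⊕ H) = x
⊕ H`. -/
theorem IsLSubgyrogroup.leftCoset_eq_iff {H : Set G} (hH : IsLSubgyrogroup H) {x y : G} :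
    leftCoset x H = leftCoset y H ↔ -x + y ∈ H := by
  rw [← mem_leftCoset_iff]
  constructor
  · intro h
    rw [h]
    exact ⟨0, hH.zero_mem, add_zero' y⟩
  · rintro ⟨h, hh, rfl⟩
    have hadd : leftCoset h H = H := hH.leftCoset_eq_self hh
    have key : leftCoset (x + h) H = leftCoset x (leftCoset h H) := by
      have hg := hH.gyr_image x h hh
      conv_lhs => rw [← hg]
      simp only [leftCoset, image_image]
      exact image_congr fun k _ => (gyr_assoc x h k).symm
    rw [key, hadd]

end Algebra

/-! ### Compact sets of countable character -/

section TopologicalBasics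

variable {G : Type*} [TopologicalSpace G] [Gyrogroup G] [IsTopologicalGyrogroup G]

theorem preimage_add_left_mem_nhds {a x : G} {O : Set G} (hO : O ∈ 𝓝 (a + x)) :
    (fun y => a + y) ⁻¹' O ∈ 𝓝 x :=
  (continuous_const_add a).continuousAt hO

theorem isFeathered_of_isCompact_coset_metrizable {H : Set G} (hH : IsSubgyrogroup H)
    (hc : IsCompact H) (hm : TopologicalSpace.MetrizableSpace (CosetSpace H)) :
    IsFeathered G := by
  refine ⟨H, hH.nonempty, hc, ?_⟩
  let π : G → CosetSpace H := Quotient.mk _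
  have hπ : Continuous π := continuous_quotient_mk'
  obtain ⟨B, hB⟩ := (𝓝 (π 0)).exists_antitone_basis
  have hπH : ∀ h ∈ H, π h = π 0 := fun h hh => Quotient.sound
    ((hH.leftCoset_eq_self hh).trans (leftCoset_zero H).symm)
  refine ⟨range fun n => π ⁻¹' interior (B n), countable_range _, ?_, ?_⟩
  · rintro _ ⟨n, rfl⟩
    refine ⟨isOpen_interior.preimage hπ, fun h hh => ?_⟩
    rw [mem_preimage, hπH h hh]
    exact mem_interior_iff_mem_nhds.2 (hB.mem n)
  · intro V hV hHV
    -- The largest union of cosets inside `V`; compactness of `H` makes it open.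
    let W : Set G := {x | leftCoset x H ⊆ V}
    have hWopen : IsOpen W := by
      rw [isOpen_iff_mem_nhds]
      intro x hx
      have : ∀ᶠ y in 𝓝 x, ∀ h ∈ H, y + h ∈ V := by
        apply hc.eventually_forall_of_forall_eventually
        intro h hh
        exact continuous_add.continuousAt (hV.mem_nhds (hx ⟨h, hh, rfl⟩))
      filter_upwards [this] with y hy
      rintro _ ⟨h, hh, rfl⟩
      exact hy h hh
    have hsat : π ⁻¹' (π '' W) = W := by
      refine Subset.antisymm ?_ (subset_preimage_image π W)
      rintro x ⟨y, hy, hyx⟩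
      have hyx' : leftCoset y H = leftCoset x H := Quotient.exact hyx
      change leftCoset x H ⊆ V
      rw [← hyx']
      exact hy
    have h0 : (0 : G) ∈ W := by
      change leftCoset 0 H ⊆ V
      rwa [leftCoset_zero]
    have himg : IsOpen (π '' W) := by
      rw [← isQuotientMap_quotient_mk'.isOpen_preimage]
      exact hsat.symm ▸ hWopen
    obtain ⟨n, hn⟩ := hB.mem_iff.1 (himg.mem_nhds ⟨0, h0, rfl⟩)
    refine ⟨_, ⟨n, rfl⟩, fun x hx => ?_⟩
    have hxW : x ∈ W := by
      rw [← hsat]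
      exact hn (interior_subset hx)
    exact hxW ⟨0, hH.zero_mem, add_zero' x⟩

theorem exists_isCompact_zero_mem_of_isFeathered (hG : IsFeathered G) :
    ∃ K : Set G, 0 ∈ K ∧ IsCompact K ∧ HasCountableCharacter K := by
  obtain ⟨K, ⟨a, ha⟩, hc, γ, hγ, hγK, hbase⟩ := hG
  have himage : (fun x => -a + x) '' K = (fun x => a + x) ⁻¹' K := by
    ext x
    constructor
    · rintro ⟨y, hy, rfl⟩
      rwa [mem_preimage, add_neg_cancel_left']
    · intro hx
      exact ⟨a + x, hx, neg_add_cancel_left' a x⟩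
  refine ⟨(fun x => a + x) ⁻¹' K, ?_, ?_,
    (fun U => (fun x => a + x) ⁻¹' U) '' γ, hγ.image _, ?_, ?_⟩
  · rwa [mem_preimage, add_zero']
  · rw [← himage]
    exact hc.image (continuous_const_add (-a))
  · rintro _ ⟨U, hU, rfl⟩
    exact ⟨(hγK U hU).1.preimage (continuous_const_add a), preimage_mono (hγK U hU).2⟩
  · intro V hV hKV
    obtain ⟨U, hU, hUV⟩ := hbase ((fun x => -a + x) ⁻¹' V) (hV.preimage (continuous_const_add _))
      (image_subset_iff.1 (himage.trans_subset hKV))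
    refine ⟨_, ⟨U, hU, rfl⟩, fun x hx => ?_⟩
    have := hUV hx
    rwa [mem_preimage, neg_add_cancel_left'] at this

end TopologicalBasics

/-! ### Invariant chains and their uniformity -/

/-- A sequence of symmetric neighbourhoods of `0`, invariant under all gyroautomorphisms, with
`V (n + 1) ⊕ V (n + 1) ⊆ V n`. -/
structure IsInvariantChain {G : Type*} [TopologicalSpace G] [Gyrogroup G] (V : ℕ → Set G) :
    Prop where
  mem_nhds : ∀ n, V n ∈ 𝓝 (0 : G)
  gyr_mem_iff : ∀ n (x y z : G), gyr x y z ∈ V n ↔ z ∈ V n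
  neg_mem : ∀ n, ∀ v ∈ V n, -v ∈ V n
  add_mem : ∀ n, ∀ v ∈ V (n + 1), ∀ w ∈ V (n + 1), v + w ∈ V n

theorem exists_gyr_invariant_add_subset {G : Type*} [TopologicalSpace G] [Gyrogroup G]
    [IsStronglyTopologicalGyrogroup G] {N : Set G} (hN : N ∈ 𝓝 (0 : G)) :
    ∃ V ∈ 𝓝 (0 : G), (∀ x y z : G, gyr x y z ∈ V ↔ z ∈ V) ∧ (∀ v ∈ V, -v ∈ V) ∧
      ∀ v ∈ V, ∀ w ∈ V, v + w ∈ N := by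
  obtain ⟨S, hbasis, hinv⟩ :=
    IsStronglyTopologicalGyrogroup.exists_gyr_invariant_basis (G := G)
  have hcont : Tendsto (fun p : G × G => p.1 + p.2) (𝓝 0 ×ˢ 𝓝 0) (𝓝 0) := by
    have h := (continuous_add (M := G)).tendsto (0, 0)
    rwa [nhds_prod_eq, zero_add'] at h
  obtain ⟨U, hU, hUN⟩ := (hbasis.prod_self.tendsto_iff (basis_sets _)).1 hcont N hN
  have hU0 : U ∈ 𝓝 (0 : G) := hbasis.mem_of_mem hU
  have hmem : ∀ x y z : G, gyr x y z ∈ U ↔ z ∈ U := fun x y z => by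
    conv_lhs => rw [← hinv U hU x y]
    exact (gyr x y).injective.mem_set_image
  have hneg0 : -(0 : G) = 0 := (neg_unique 0 0 ⟨zero_add' 0, zero_add' 0⟩).symm
  -- Gyrations commute with `⊖`, so symmetrizing `U` keeps it invariant.
  refine ⟨U ∩ (fun x => -x) ⁻¹' U, inter_mem hU0 ?_, fun x y z => ?_, fun v hv => ?_,
    fun v hv w hw => hUN (v, w) ⟨hv.1, hw.1⟩⟩
  · refine (continuous_neg (G := G)).continuousAt ?_
    rwa [hneg0]
  · rw [mem_inter_iff, mem_inter_iff, mem_preimage, mem_preimage, ← gyr_map_neg, hmem, hmem]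
  · exact ⟨hv.2, by rw [mem_preimage, neg_neg']; exact hv.1⟩

theorem exists_isInvariantChain {G : Type*} [TopologicalSpace G] [Gyrogroup G]
    [IsStronglyTopologicalGyrogroup G] (N : ℕ → Set G) (hN : ∀ n, N n ∈ 𝓝 (0 : G)) :
    ∃ V : ℕ → Set G, IsInvariantChain V ∧ ∀ n, V (n + 1) ⊆ N n := by
  choose! F hF0 hFg hFn hFa using fun (M : Set G) (hM : M ∈ 𝓝 (0 : G)) =>
    exists_gyr_invariant_add_subset hM
  -- Halving `W ∩ N n` rather than `W` gives the chain condition and `V (n + 1) ⊆ N n` together.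
  let V : ℕ → Set G := fun n => Nat.rec (F univ) (fun n W => F (W ∩ N n)) n
  have hV : ∀ n, V n ∈ 𝓝 (0 : G) := by
    intro n
    induction n with
    | zero => exact hF0 _ univ_mem
    | succ n ih => exact hF0 _ (inter_mem ih (hN n))
  have hVN : ∀ n, V n ∩ N n ∈ 𝓝 (0 : G) := fun n => inter_mem (hV n) (hN n)
  refine ⟨V, ⟨hV, fun n => ?_, fun n => ?_, fun n v hv w hw => (hFa _ (hVN n) v hv w hw).1⟩,
    fun n v hv => ?_⟩
  · cases n with
    | zero => exact hFg _ univ_mem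
    | succ n => exact hFg _ (hVN n)
  · cases n with
    | zero => exact hFn _ univ_mem
    | succ n => exact hFn _ (hVN n)
  · have := (hFa _ (hVN n) v hv 0 (mem_of_mem_nhds (hV (n + 1)))).2
    rwa [add_zero'] at this

namespace IsInvariantChain

variable {G : Type*} [TopologicalSpace G] [Gyrogroup G] {V : ℕ → Set G}

theorem zero_mem (hV : IsInvariantChain V) (n : ℕ) : (0 : G) ∈ V n :=
  mem_of_mem_nhds (hV.mem_nhds n)

theorem antitone (hV : IsInvariantChain V) : Antitone V :=
  antitone_nat_of_succ_le fun n v hv => by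
    simpa only [add_zero'] using hV.add_mem n v hv 0 (hV.zero_mem _)

theorem gyr_symm_mem_iff (hV : IsInvariantChain V) (n : ℕ) (x y z : G) :
    (gyr x y).symm z ∈ V n ↔ z ∈ V n := by
  rw [← hV.gyr_mem_iff n x y, AddEquiv.apply_symm_apply]

/-- With `y = x ⊕ v`, the element `⊖y ⊕ x` is `gyr[x, v](⊖v)`, and `V n` is symmetric and invariant.
-/
theorem neg_add_mem_symm (hV : IsInvariantChain V) {n : ℕ} {x y : G} (h : -x + y ∈ V n) :
    -y + x ∈ V n := by
  have hy : y = x + (-x + y) := (add_neg_cancel_left' x y).symm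
  generalize -x + y = v at h hy
  subst hy
  have : -(x + v) + x = gyr x v (-v) := by
    apply add_left_cancel' (x + v)
    rw [add_neg_cancel_left', add_add_gyr_neg]
  rw [this, hV.gyr_mem_iff]
  exact hV.neg_mem n v h

/-- Reassociating `(x ⊕ v) ⊕ w` only replaces `w` by its image under an inverse gyration, which
stays in `V (n + 1)`. -/
theorem neg_add_mem_trans (hV : IsInvariantChain V) {n : ℕ} {x y z : G}
    (hxy : -x + y ∈ V (n + 1)) (hyz : -y + z ∈ V (n + 1)) : -x + z ∈ V n := by
  have hy : y = x + (-x + y) := (add_neg_cancel_left' x y).symm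
  have hz : z = y + (-y + z) := (add_neg_cancel_left' y z).symm
  generalize -x + y = v at hxy hy
  generalize -y + z = w at hyz hz
  subst hy
  subst hz
  rw [add_assoc_gyr_symm, neg_add_cancel_left']
  exact hV.add_mem n v hxy _ ((hV.gyr_symm_mem_iff _ _ _ _).2 hyz)

theorem setOf_neg_add_mem_nhds [IsTopologicalGyrogroup G] (hV : IsInvariantChain V) (n : ℕ)
    (x : G) : {y | -x + y ∈ V n} ∈ 𝓝 x := by
  apply preimage_add_left_mem_nhds
  rw [neg_add']
  exact hV.mem_nhds n

theorem isLSubgyrogroup_iInter (hV : IsInvariantChain V) : IsLSubgyrogroup (⋂ n, V n) where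
  nonempty := ⟨0, mem_iInter.2 hV.zero_mem⟩
  neg_mem x hx := mem_iInter.2 fun n => hV.neg_mem n x (mem_iInter.1 hx n)
  add_mem x hx y hy := mem_iInter.2 fun n =>
    hV.add_mem n x (mem_iInter.1 hx _) y (mem_iInter.1 hy _)
  gyr_image a h _ := by
    apply Subset.antisymm
    · rintro _ ⟨k, hk, rfl⟩
      exact mem_iInter.2 fun n => (hV.gyr_mem_iff n a h k).2 (mem_iInter.1 hk n)
    · intro k hk
      refine ⟨(gyr a h).symm k, mem_iInter.2 fun n => ?_, AddEquiv.apply_symm_apply _ _⟩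
      exact (hV.gyr_symm_mem_iff n a h k).2 (mem_iInter.1 hk n)

theorem closure_subset [IsTopologicalGyrogroup G] (hV : IsInvariantChain V) (n : ℕ) :
    closure (V (n + 1)) ⊆ V n := by
  intro x hx
  obtain ⟨w, hxw, hw⟩ := mem_closure_iff_nhds.1 hx _ (hV.setOf_neg_add_mem_nhds (n + 1) x)
  have h0 : -(0 : G) + w ∈ V (n + 1) := by
    rwa [← neg_unique 0 0 ⟨zero_add' 0, zero_add' 0⟩, zero_add']
  have := hV.neg_add_mem_trans h0 (hV.neg_add_mem_symm hxw)
  rwa [← neg_unique 0 0 ⟨zero_add' 0, zero_add' 0⟩, zero_add'] at this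

theorem iInter_closure [IsTopologicalGyrogroup G] (hV : IsInvariantChain V) :
    ⋂ n, closure (V n) = ⋂ n, V n :=
  Subset.antisymm (subset_iInter fun n => (iInter_subset _ (n + 1)).trans (hV.closure_subset n))
    (iInter_mono fun _ => subset_closure)

theorem isClosed_iInter [IsTopologicalGyrogroup G] (hV : IsInvariantChain V) :
    IsClosed (⋂ n, V n) := by
  rw [← hV.iInter_closure]
  exact _root_.isClosed_iInter fun _ => isClosed_closure

/-- The uniformity with the entourages `{(x, y) | ⊖x ⊕ y ∈ V n}`. -/
def uniformCore (hV : IsInvariantChain V) : UniformSpace.Core G where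
  uniformity := ⨅ n, 𝓟 {p : G × G | -p.1 + p.2 ∈ V n}
  refl := le_iInf fun n => principal_mono.2 fun p hp => by
    obtain ⟨x, y⟩ := p
    obtain rfl : x = y := hp
    rw [mem_ofPred_eq, neg_add']
    exact hV.zero_mem n
  symm := tendsto_iInf_iInf fun n => tendsto_principal_principal.2 fun p hp =>
    hV.neg_add_mem_symm hp
  comp := le_iInf fun n => le_principal_iff.2 <| by
    refine mem_of_superset (mem_lift' (mem_iInf_of_mem (n + 1) (mem_principal_self _))) ?_
    rintro ⟨x, z⟩ ⟨y, hxy, hyz⟩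
    exact hV.neg_add_mem_trans hxy hyz

theorem hasAntitoneBasis_uniformCore (hV : IsInvariantChain V) :
    hV.uniformCore.uniformity.HasAntitoneBasis fun n => {p : G × G | -p.1 + p.2 ∈ V n} :=
  HasAntitoneBasis.iInf_principal fun _ _ h _ hp => hV.antitone h hp

end IsInvariantChain

end Gyrogroup

/-! ### Metrizability of the coset space -/

theorem metrizableSpace_separationQuotient {X : Type*} [UniformSpace X]
    [IsCountablyGenerated (𝓤 X)] : TopologicalSpace.MetrizableSpace (SeparationQuotient X) := by
  have : IsCountablyGenerated (𝓤 (SeparationQuotient X)) := by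
    rw [SeparationQuotient.uniformity_eq]
    infer_instance
  infer_instance

/-- The quotient topology sees only saturated sets, so the two topologies on `X` need to agree only
on those. -/
theorem metrizableSpace_quotient_of_inseparableSetoid {X : Type*} [t : TopologicalSpace X]
    {s : Setoid X} (u : UniformSpace X) (hu : IsCountablyGenerated (𝓤[u]))
    (hs : s = @inseparableSetoid X u.toTopologicalSpace)
    (ho : ∀ O : Set X, (∀ x y, s x y → x ∈ O → y ∈ O) →
      (IsOpen[t] O ↔ IsOpen[u.toTopologicalSpace] O)) :
    TopologicalSpace.MetrizableSpace (Quotient s) := by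
  have htop : @instTopologicalSpaceQuotient X s t =
      @instTopologicalSpaceQuotient X s u.toTopologicalSpace := by
    ext O
    refine ho _ fun x y hxy hx => ?_
    have : (Quotient.mk s x) = Quotient.mk s y := Quotient.sound hxy
    change Quotient.mk s y ∈ O
    rw [← this]
    exact hx
  rw [htop]
  subst hs
  exact metrizableSpace_separationQuotient

namespace Gyrogroup

variable {G : Type*} [TopologicalSpace G] [Gyrogroup G]

theorem IsInvariantChain.metrizableSpace_cosetSpace [IsTopologicalGyrogroup G] {V : ℕ → Set G}
    (hV : IsInvariantChain V)
    (hbase : ∀ O : Set G, IsOpen O → ⋂ n, V n ⊆ O → ∃ n, V n ⊆ O) :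
    TopologicalSpace.MetrizableSpace (CosetSpace (⋂ n, V n)) := by
  have hL := hV.isLSubgyrogroup_iInter
  have hB := hV.hasAntitoneBasis_uniformCore
  let u : UniformSpace G := UniformSpace.ofCore hV.uniformCore
  have hrel : ∀ x y : G, cosetSetoid (⋂ n, V n) x y ↔ ∀ n, -x + y ∈ V n := fun x y =>
    hL.leftCoset_eq_iff.trans mem_iInter
  refine metrizableSpace_quotient_of_inseparableSetoid u hB.isCountablyGenerated ?_ ?_
  · ext x y
    rw [hrel]
    have := @Filter.HasBasis.inseparable_iff_uniformity G u _ _ _ hB.toHasBasis x y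
    simp only [true_imp_iff] at this
    exact this.symm
  · intro O hsat
    rw [@isOpen_iff_ball_subset G u]
    constructor
    · intro hO x hx
      -- Saturation gives `x ⊕ H ⊆ O`, so the translated set is an open neighbourhood of `H`.
      obtain ⟨n, hn⟩ := hbase ((fun y => x + y) ⁻¹' O) (hO.preimage (continuous_const_add x))
        fun h hh => hsat x _ ((hrel _ _).2 fun n => by
          rw [neg_add_cancel_left']
          exact mem_iInter.1 hh n) hx
      refine ⟨_, hB.mem n, fun y hy => ?_⟩
      have := hn hy
      rwa [mem_preimage, add_neg_cancel_left'] at this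
    · intro h
      rw [isOpen_iff_mem_nhds]
      intro x hx
      obtain ⟨W, hW, hWO⟩ := h x hx
      obtain ⟨n, hn⟩ := hB.mem_iff.1 hW
      exact mem_of_superset (hV.setOf_neg_add_mem_nhds n x) fun y hy => hWO (hn hy)

theorem exists_isLSubgyrogroup_of_isFeathered [T1Space G] [IsStronglyTopologicalGyrogroup G]
    (hG : IsFeathered G) :
    ∃ H : Set G, IsLSubgyrogroup H ∧ IsCompact H ∧
      TopologicalSpace.MetrizableSpace (CosetSpace H) := by
  obtain ⟨K, h0, hK, γ, hγ, hγK, hγbase⟩ := exists_isCompact_zero_mem_of_isFeathered hG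
  obtain ⟨U₀, hU₀, -⟩ := hγbase univ isOpen_univ (subset_univ K)
  obtain ⟨U, rfl⟩ := hγ.exists_eq_range ⟨U₀, hU₀⟩
  obtain ⟨V, hV, hVU⟩ := exists_isInvariantChain U fun n =>
    (hγK _ ⟨n, rfl⟩).1.mem_nhds ((hγK _ ⟨n, rfl⟩).2 h0)
  have hHK : ⋂ n, V n ⊆ K := by
    intro x hx
    by_contra hxK
    obtain ⟨_, ⟨n, rfl⟩, hn⟩ := hγbase {x}ᶜ isOpen_compl_singleton
      (subset_compl_singleton_iff.2 hxK)
    exact hn (hVU n (mem_iInter.1 hx (n + 1))) rfl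
  refine ⟨⋂ n, V n, hV.isLSubgyrogroup_iInter, hK.of_isClosed_subset hV.isClosed_iInter hHK,
    hV.metrizableSpace_cosetSpace fun O hO hHO => ?_⟩
  -- The closures also intersect in `H ⊆ O`, so by compactness some `closure (V m)` misses `K \ O`.
  obtain ⟨m, hm⟩ := (hK.diff hO).elim_directed_family_closed (fun n => closure (V n))
    (fun n => isClosed_closure)
    (by
      rw [hV.iInter_closure]
      exact disjoint_iff_inter_eq_empty.1 (disjoint_sdiff_left.mono_right hHO))
    (directed_of_isDirected_le fun _ _ h => closure_mono (hV.antitone h))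
  -- This open set contains `K`, hence some `U n ⊇ V (n + 1)`; within `V m` the second piece is
  -- excluded.
  obtain ⟨_, ⟨n, rfl⟩, hn⟩ := hγbase (O ∪ (closure (V m))ᶜ)
    (hO.union isClosed_closure.isOpen_compl) fun x hx => by
      by_contra hxn
      rw [mem_union, not_or, notMem_compl_iff] at hxn
      exact (hm.subset ⟨⟨hx, hxn.1⟩, hxn.2⟩ : x ∈ (∅ : Set G))
  refine ⟨max m (n + 1), fun x hx => ?_⟩
  refine (hn (hVU n (hV.antitone (le_max_right _ _) hx))).resolve_right fun h => h ?_
  exact subset_closure (hV.antitone (le_max_left _ _) hx)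

end Gyrogroup

theorem mainTheorem2 (G : Type*) [TopologicalSpace G] [T1Space G] [Gyrogroup G]
    [IsStronglyTopologicalGyrogroup G] :
    IsFeathered G ↔
      ∃ H : Set G, Gyrogroup.IsLSubgyrogroup H ∧ IsCompact H ∧
        TopologicalSpace.MetrizableSpace (Gyrogroup.CosetSpace H) := by
  constructor
  · exact Gyrogroup.exists_isLSubgyrogroup_of_isFeathered
  · rintro ⟨H, hH, hc, hm⟩
    exact Gyrogroup.isFeathered_of_isCompact_coset_metrizable hH.toIsSubgyrogroup hc hm
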